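/- **Setting.** Let $S$ be a compact oriented decorated surface with a triangulation $\underline\Delta$, i.e. $S$ is glued from finitely many triangles along digons: some of the oriented sides of the triangles are joined in pairs $\{s,\bar s\}$ of distinct sides by digons (orientations of the two sides opposed; self-folded triangles allowed), the remaining sides being boundary sides. Truncating the corners, each triangle becomes a hexagon and each digon a rectangle, with alternating long and short edges; the cut-off corners form the $T$-regions. The *fencing graph* $\Gamma$ has as vertices the corners of the hexagons (one $T$-gate at each), as long edges the long edges of the hexagons, and as short edges the short edges of hexagons and rectangles, oriented clockwise around the $T$-regions, $e$ going from its tail $t(e)$ to its head $h(e)$. The short edges in a $T$-region form either a path (the $T$-region is then a disk, called a *marked point*) or a circle (the $T$-region is then an annulus, called a *puncture*). A distinguished gate is fixed in each $T$-region; $M$ and $P$ denote the sets of distinguished gates at the marked points and at the punctures, and $\widetilde P$ the set of all other gates, together with $P$, so that $M\cup\widetilde P$ is the set of all vertices of $\Gamma$. For a set $X$ of vertices of $\Gamma$, $H_1(S,X)$ is the first homology of $S$ relative to $X$ with $\mathbb Z/2$ coefficients (punctures are boundary circles and are not filled in); it is computed from the cell decomposition given by $\Gamma$ with the hexagons and rectangles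 as faces, onto whose union $S$ retracts. Let $k$ be a commutative ring with an invertible element $q^{1/2}$. Let $\widetilde\zeta_{\mathrm{SL}_2}$ be the $k$-algebra with invertible generators $A_\ell$ for the long edges and $a_e$ for the short edges of $\Gamma$, and relations $A_\ell A_{\ell'}=A_{\ell'}A_\ell$; $a_eA_\ell=q^{1/2}A_\ell a_e$ if $e$ and $\ell$ share a vertex and $a_eA_\ell=A_\ell a_e$ otherwise; $a_ea_{e'}=q^{1/2}a_{e'}a_e$ if $h(e)=t(e')$ and $t(e)\ne h(e')$, and $a_ea_{e'}=a_{e'}a_e$ if neither or both of $h(e)=t(e')$, $t(e)=h(e')$ hold; and $a_1A_2=a_2A_1$ for each rectangle with long edges $A_1,A_2$ and short edges $a_1,a_2$, where $a_1$ runs from an endpoint of $A_1$ to one of $A_2$, and $a_2$ from an endpoint of $A_2$ to one of $A_1$. It is graded by weights at the vertices of $\Gamma$: $A_\ell$ has weight $1$ at its two endpoints, $a_e$ has weight $1$ at $t(e)$ and $-1$ at $h(e)$, and all other weights are $0$. Let $\widetilde\zeta_{\mathrm{PGL}_2}\subset\widetilde\zeta_{\mathrm{SL}_2}$ be the subalgebra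 generated by the $A_\ell^{\pm2}$, the $a_e^{\pm2}$ and, for each triangle, the product of the six generators on its hexagon and its inverse. For $G=\mathrm{SL}_2,\mathrm{PGL}_2$ let $\zeta_G$, $\chi_G$, $\eta_G$ be the subalgebras of $\widetilde\zeta_G$ of torus invariants, i.e. the parts of weight zero at all vertices outside $M\cup P$, outside $M$, and at all vertices, respectively. A *monomial* is a product of generators and their inverses. **Proposition.** 1. $\eta_{\mathrm{SL}_2}$ is a free (left) module over $\eta_{\mathrm{PGL}_2}$ of rank $|H_1(S)|$. 2. $\chi_{\mathrm{SL}_2}$ is a free module over $\chi_{\mathrm{PGL}_2}$ of rank $|H_1(S,M)|$. 3. $\zeta_{\mathrm{SL}_2}$ is a free module over $\zeta_{\mathrm{PGL}_2}$ of rank $|H_1(S,M\cup P)|$. 4. $\widetilde\zeta_{\mathrm{SL}_2}$ is a free module over $\widetilde\zeta_{\mathrm{PGL}_2}$ of rank $|H_1(S,M\cup\widetilde P)|$. Moreover, in each case there are monomials $M_1,\dots,M_N$ in the $\mathrm{SL}_2$ torus, where $2^N$ is the rank, such that each $M_i^2$ lies in the corresponding $\mathrm{PGL}_2$ torus and the products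 $M_1^{\varepsilon_1}\cdots M_N^{\varepsilon_N}$ with $\varepsilon_i\in\{0,1\}$ form a free basis. -/

import Mathlib

noncomputable section

/-- A side of one of the triangles in `T`.  The three corners of every triangle are numbered
`0, 1, 2` counterclockwise, and the side `(τ, i)` runs from corner `i` to corner `i + 1`. -/
abbrev TriangleSide (T : Type*) := T × Fin 3

/-- A triangulation of an oriented decorated surface: the triangles in `T` are glued along digons.
Two different sides `s` and `glue s` are joined by a digon, with the orientations of the two sides
opposed; the fixed points of `glue` are the sides on the boundary of the surface.
Self-folded triangles and triangles sharing several sides are allowed. -/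
structure SurfaceTriangulation (T : Type*) where
  glue : TriangleSide T → TriangleSide T
  glue_glue : ∀ s, glue (glue s) = s

/-- Kernel modulo image, for `A → B → C`. -/
abbrev middleHomology {R A B C : Type*} [Ring R] [AddCommGroup A] [AddCommGroup B]
    [AddCommGroup C] [Module R A] [Module R B] [Module R C] (f : A →ₗ[R] B) (g : B →ₗ[R] C) :=
  LinearMap.ker g ⧸ (LinearMap.range f).submoduleOf (LinearMap.ker g)

namespace SurfaceTriangulation

variable {T : Type*} (Δ : SurfaceTriangulation T)

/-- Sides that are joined to another side by a digon. -/
abbrev InnerSide := {s : TriangleSide T // Δ.glue s ≠ s}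

/-- The inner side at the other end of the digon. -/
def opp (s : Δ.InnerSide) : Δ.InnerSide :=
  ⟨Δ.glue s.1, fun h => s.2 ((Δ.glue_glue s.1).symm.trans h).symm⟩

theorem opp_opp (s : Δ.InnerSide) : Δ.opp (Δ.opp s) = s :=
  Subtype.ext (Δ.glue_glue s.1)

/-! ### The fencing graph -/

/-- The vertices of the fencing graph are the corners of the hexagons obtained by truncating the
triangles: `(s, false)` is the beginning and `(s, true)` is the end of the long edge on the
side `s`. There is one `T`-gate at each of them. -/
abbrev Vertex (_Δ : SurfaceTriangulation T) := TriangleSide T × Bool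

/-- Short edges: every hexagon has one at each of its three corners (`hex (τ, i)` is the one
at the corner `i + 1` of `τ`), and the digon joining `s` and `opp s` has the two short edges
`rect s` and `rect (opp s)`. -/
inductive ShortEdge
  | hex (s : TriangleSide T) : ShortEdge
  | rect (s : Δ.InnerSide) : ShortEdge

/-- Edges of the fencing graph: the long edges, one for each side of each triangle, and the
short edges. -/
inductive Edge
  | long (s : TriangleSide T) : Edge
  | short (e : Δ.ShortEdge) : Edge

variable {Δ}

/-- Tail of a short edge; short edges run clockwise around the `T`-regions. -/
def ShortEdge.tail : Δ.ShortEdge → Δ.Vertex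
  | .hex s => (s, true)
  | .rect s => (s.1, false)

/-- Head of a short edge. -/
def ShortEdge.head : Δ.ShortEdge → Δ.Vertex
  | .hex s => ((s.1, s.2 + 1), false)
  | .rect s => ((Δ.opp s).1, true)

/-- The long edge on the side `s` and the short edge `e` have a common endpoint. -/
def ShortEdge.Touches (e : Δ.ShortEdge) (s : TriangleSide T) : Prop :=
  e.tail.1 = s ∨ e.head.1 = s

variable (Δ)

/-- The `T`-regions: two vertices of the fencing graph lie in the same `T`-region if and only if
they are connected by short edges. -/
def TRegion := Quot fun u w : Δ.Vertex => ∃ e : Δ.ShortEdge, e.tail = u ∧ e.head = w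

/-- The `T`-region containing a vertex of the fencing graph. -/
def regionOf (u : Δ.Vertex) : Δ.TRegion := Quot.mk _ u

/-- The `T`-region is a disk at a boundary point, a marked point, if the short edges in it form
a path, that is if a boundary side ends in it; otherwise they form a circle, the `T`-region is an
annulus, and it is a puncture. -/
def IsMarkedPoint (r : Δ.TRegion) : Prop :=
  ∃ u : Δ.Vertex, Δ.regionOf u = r ∧ Δ.glue u.1 = u.1

/-- A notching: a distinguished vertex (gate) in each `T`-region. -/
structure Notching where
  vertex : Δ.TRegion → Δ.Vertex
  regionOf_vertex : ∀ r, Δ.regionOf (vertex r) = r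

/-- The distinguished gates at the marked points. -/
def Notching.markedGates {Δ : SurfaceTriangulation T} (N : Δ.Notching) : Set Δ.Vertex :=
  N.vertex '' {r | Δ.IsMarkedPoint r}

/-- The distinguished gates at the marked points and at the punctures. -/
def Notching.gates {Δ : SurfaceTriangulation T} (N : Δ.Notching) : Set Δ.Vertex :=
  Set.range N.vertex

/-! ### Homology with coefficients in `ℤ/2`

The hexagons and the rectangles (truncated digons) are the faces of a cell decomposition of
the `G`-part of the surface, with the fencing graph as its 1-skeleton. The surface retracts onto
this part, because the `T`-regions are annular collars and half-disks attached to it along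
the circles and paths of short edges. -/

/-- Rectangles: the digons, each of them joining two sides `s` and `opp s`. -/
def Rectangle := Quot fun s s' : Δ.InnerSide => s' = Δ.opp s

/-- The faces. -/
abbrev Face := T ⊕ Δ.Rectangle

/-- The endpoints of an edge as a `0`-chain. -/
def edgeBoundary : Δ.Edge → (Δ.Vertex →₀ ZMod 2)
  | .long s => Finsupp.single (s, false) 1 + Finsupp.single (s, true) 1
  | .short e => Finsupp.single e.tail 1 + Finsupp.single e.head 1

/-- The edge as a `1`-chain. -/
def edgeChain (e : Δ.Edge) : Δ.Edge →₀ ZMod 2 := Finsupp.single e 1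

/-- The boundary of the hexagon in the triangle `τ`. -/
def hexagonBoundary (τ : T) : Δ.Edge →₀ ZMod 2 :=
  ∑ i : Fin 3, (Δ.edgeChain (.long (τ, i)) + Δ.edgeChain (.short (.hex (τ, i))))

/-- The boundary of a rectangle. -/
def rectangleBoundary : Δ.Rectangle → (Δ.Edge →₀ ZMod 2) :=
  Quot.lift
    (fun s => (Δ.edgeChain (.long s.1) + Δ.edgeChain (.long (Δ.opp s).1)) +
      (Δ.edgeChain (.short (.rect s)) + Δ.edgeChain (.short (.rect (Δ.opp s)))))
    (by
      rintro s _ rfl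
      rw [opp_opp]
      congr 1 <;> exact add_comm _ _)

/-- The cellular boundary map from `1`-chains to `0`-chains. -/
def boundary₁ : (Δ.Edge →₀ ZMod 2) →ₗ[ZMod 2] (Δ.Vertex →₀ ZMod 2) :=
  Finsupp.linearCombination (ZMod 2) Δ.edgeBoundary

/-- The cellular boundary map from `2`-chains to `1`-chains. -/
def boundary₂ : (Δ.Face →₀ ZMod 2) →ₗ[ZMod 2] (Δ.Edge →₀ ZMod 2) :=
  Finsupp.linearCombination (ZMod 2) (Sum.elim Δ.hexagonBoundary Δ.rectangleBoundary)

/-- The relative boundary map to the relative `0`-chains, for a set `X` of vertices. -/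
def relBoundary₁ (X : Set Δ.Vertex) : (Δ.Edge →₀ ZMod 2) →ₗ[ZMod 2]
    ((Δ.Vertex →₀ ZMod 2) ⧸ Finsupp.supported (ZMod 2) (ZMod 2) X) :=
  (Finsupp.supported (ZMod 2) (ZMod 2) X).mkQ ∘ₗ Δ.boundary₁

theorem boundary₁_comp_boundary₂ : Δ.boundary₁ ∘ₗ Δ.boundary₂ = 0 := by
  have two (x : Δ.Vertex →₀ ZMod 2) : x + x = 0 := by
    ext u; exact CharTwo.add_self_eq_zero _
  apply Finsupp.lhom_ext'
  rintro (τ | r)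
  · ext1
    simp only [LinearMap.comp_apply, boundary₁, boundary₂, Finsupp.lsingle_apply,
      Finsupp.linearCombination_single, Sum.elim_inl, hexagonBoundary, edgeChain,
      map_add, one_smul, edgeBoundary, Fin.sum_univ_three, LinearMap.zero_apply,
      ShortEdge.tail, ShortEdge.head]
    have h0 : (0 : Fin 3) + 1 = 1 := rfl
    have h1 : (1 : Fin 3) + 1 = 2 := rfl
    have h2 : (2 : Fin 3) + 1 = 0 := rfl
    rw [h0, h1, h2]
    set a := Finsupp.single (((τ, (0 : Fin 3)), false) : Δ.Vertex) (1 : ZMod 2)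
    set b := Finsupp.single (((τ, (0 : Fin 3)), true) : Δ.Vertex) (1 : ZMod 2)
    set c := Finsupp.single (((τ, (1 : Fin 3)), false) : Δ.Vertex) (1 : ZMod 2)
    set d := Finsupp.single (((τ, (1 : Fin 3)), true) : Δ.Vertex) (1 : ZMod 2)
    set e := Finsupp.single (((τ, (2 : Fin 3)), false) : Δ.Vertex) (1 : ZMod 2)
    set f := Finsupp.single (((τ, (2 : Fin 3)), true) : Δ.Vertex) (1 : ZMod 2)
    calc _ = (a + a) + (b + b) + (c + c) + (d + d) + (e + e) + (f + f) := by abel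
      _ = 0 := by simp [two]
  · ext1
    simp only [LinearMap.comp_apply, boundary₁, boundary₂, Finsupp.lsingle_apply,
      Finsupp.linearCombination_single, Sum.elim_inr, one_smul, LinearMap.zero_apply]
    induction r using Quot.ind with
    | mk s =>
      change Finsupp.linearCombination (ZMod 2) Δ.edgeBoundary
        ((Δ.edgeChain (.long s.1) + Δ.edgeChain (.long (Δ.opp s).1)) +
          (Δ.edgeChain (.short (.rect s)) + Δ.edgeChain (.short (.rect (Δ.opp s))))) = 0
      simp only [edgeChain, map_add, Finsupp.linearCombination_single, one_smul, edgeBoundary,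
        ShortEdge.tail, ShortEdge.head, opp_opp]
      set a := Finsupp.single ((s.1, false) : Δ.Vertex) (1 : ZMod 2)
      set b := Finsupp.single ((s.1, true) : Δ.Vertex) (1 : ZMod 2)
      set c := Finsupp.single (((Δ.opp s).1, false) : Δ.Vertex) (1 : ZMod 2)
      set d := Finsupp.single (((Δ.opp s).1, true) : Δ.Vertex) (1 : ZMod 2)
      calc _ = (a + a) + (b + b) + (c + c) + (d + d) := by abel
        _ = 0 := by simp [two]

/-- `H₁(S, X; ℤ/2)` for a set `X` of vertices of the fencing graph (as points of the surface):
relative cycles modulo boundaries. -/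
abbrev H₁ (X : Set Δ.Vertex) : Type _ :=
  middleHomology Δ.boundary₂ (Δ.relBoundary₁ X)

/-! ### The quantum tori

`k` is the ground ring and `qh` is the invertible parameter `q^{1/2}`. -/

variable (k : Type*) [CommRing k] (qh : kˣ)

/-- The free generators: `(e, false)` stands for the generator at the edge `e`
and `(e, true)` for its inverse. -/
abbrev FreeTorus := FreeAlgebra k (Δ.Edge × Bool)

/-- The free generator of the long edge on the side `s`. -/
def freeA (s : TriangleSide T) : Δ.FreeTorus k := FreeAlgebra.ι k (.long s, false)

/-- The free generator of the short edge `e`. -/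
def freea (e : Δ.ShortEdge) : Δ.FreeTorus k := FreeAlgebra.ι k (.short e, false)

/-- The fencing graph relations. -/
inductive FencingRel : Δ.FreeTorus k → Δ.FreeTorus k → Prop
  | mul_inv (e : Δ.Edge) :
      FencingRel (FreeAlgebra.ι k (e, false) * FreeAlgebra.ι k (e, true)) 1
  | inv_mul (e : Δ.Edge) :
      FencingRel (FreeAlgebra.ι k (e, true) * FreeAlgebra.ι k (e, false)) 1
  | long_long (s s' : TriangleSide T) :
      FencingRel (Δ.freeA k s * Δ.freeA k s') (Δ.freeA k s' * Δ.freeA k s)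
  | digon (s : Δ.InnerSide) :
      FencingRel (Δ.freea k (.rect s) * Δ.freeA k (Δ.opp s).1)
        (Δ.freea k (.rect (Δ.opp s)) * Δ.freeA k s.1)
  | short_long (e : Δ.ShortEdge) (s : TriangleSide T) (h : e.Touches s) :
      FencingRel (Δ.freea k e * Δ.freeA k s) ((qh : k) • (Δ.freeA k s * Δ.freea k e))
  | short_long_comm (e : Δ.ShortEdge) (s : TriangleSide T) (h : ¬ e.Touches s) :
      FencingRel (Δ.freea k e * Δ.freeA k s) (Δ.freeA k s * Δ.freea k e)
  | short_short (e e' : Δ.ShortEdge) (h : e.head = e'.tail) (h' : e.tail ≠ e'.head) :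
      FencingRel (Δ.freea k e * Δ.freea k e') ((qh : k) • (Δ.freea k e' * Δ.freea k e))
  | short_short_comm (e e' : Δ.ShortEdge) (h : e.head = e'.tail ↔ e.tail = e'.head) :
      FencingRel (Δ.freea k e * Δ.freea k e') (Δ.freea k e' * Δ.freea k e)

/-- The quantum torus of the fencing graph for `SL₂`, with all gates open. -/
abbrev Torus := RingQuot (Δ.FencingRel k qh)

/-- The invertible generator at the edge `e`. -/
def gen (e : Δ.Edge) : (Δ.Torus k qh)ˣ where
  val := RingQuot.mkAlgHom k _ (FreeAlgebra.ι k (e, false))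
  inv := RingQuot.mkAlgHom k _ (FreeAlgebra.ι k (e, true))
  val_inv := by
    rw [← map_mul, RingQuot.mkAlgHom_rel k (FencingRel.mul_inv e), map_one]
  inv_val := by
    rw [← map_mul, RingQuot.mkAlgHom_rel k (FencingRel.inv_mul e), map_one]

/-- Monomials, that is products of generators and their inverses. -/
def monomial : FreeGroup Δ.Edge →* (Δ.Torus k qh)ˣ := FreeGroup.lift (Δ.gen k qh)

/-- The weight of a generator with respect to the torus at each vertex. -/
def edgeWeight : Δ.Edge → (Δ.Vertex →₀ ℤ)
  | .long s => Finsupp.single (s, false) 1 + Finsupp.single (s, true) 1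
  | .short e => Finsupp.single e.tail 1 - Finsupp.single e.head 1

/-- The weight of a product of generators and their inverses. -/
def weight : FreeGroup Δ.Edge →* Multiplicative (Δ.Vertex →₀ ℤ) :=
  FreeGroup.lift fun e => Multiplicative.ofAdd (Δ.edgeWeight e)

/-- The words whose weight is zero at all vertices outside `X`. -/
def invariantWords (X : Set Δ.Vertex) : Submonoid (FreeGroup Δ.Edge) where
  carrier := {w | ∀ u, u ∉ X → (Δ.weight w).toAdd u = 0}
  one_mem' := by intro u _; simp
  mul_mem' := by
    intro w w' hw hw' u hu
    simp [hw u hu, hw' u hu]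

/-- The `SL₂` quantum torus in which exactly the gates in `X` are left open: the subalgebra of
invariants of the tori at all vertices outside `X`, that is the part of the weight-graded algebra
whose weights at these vertices are zero. -/
def slTorus (X : Set Δ.Vertex) : Subalgebra k (Δ.Torus k qh) :=
  (Submodule.span k
      ((fun w => (Δ.monomial k qh w : Δ.Torus k qh)) '' (Δ.invariantWords X))).toSubalgebra
    (Submodule.subset_span ⟨1, one_mem _, by simp⟩)
    (by
      intro x y hx hy
      have h := Submodule.mul_mem_mul hx hy
      rw [Submodule.span_mul_span] at h
      refine Submodule.span_mono ?_ h
      rintro _ ⟨_, ⟨w, hw, rfl⟩, _, ⟨w', hw', rfl⟩, rfl⟩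
      exact ⟨w * w', mul_mem hw hw', by simp⟩)

/-- The product of the six generators around the hexagon in the triangle `τ`. -/
def hexagonElt (τ : T) : (Δ.Torus k qh)ˣ :=
  Δ.gen k qh (.long (τ, 0)) * Δ.gen k qh (.long (τ, 1)) * Δ.gen k qh (.long (τ, 2)) *
    Δ.gen k qh (.short (.hex (τ, 0))) * Δ.gen k qh (.short (.hex (τ, 1))) *
    Δ.gen k qh (.short (.hex (τ, 2)))

/-- The `PGL₂` quantum torus with all gates open: the subalgebra generated by the squares of
the generators, the products around the hexagons, and the inverses of all of these. -/
def pglFullTorus : Subalgebra k (Δ.Torus k qh) :=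
  Algebra.adjoin k
    ({x | ∃ e : Δ.Edge, x = ↑(Δ.gen k qh e ^ (2 : ℤ)) ∨ x = ↑(Δ.gen k qh e ^ (-2 : ℤ))} ∪
      {x | ∃ τ : T, x = ↑(Δ.hexagonElt k qh τ) ∨ x = ↑(Δ.hexagonElt k qh τ)⁻¹})

/-- The `PGL₂` quantum torus in which exactly the gates in `X` are left open, as a subalgebra of
the corresponding `SL₂` quantum torus. -/
def pglTorus (X : Set Δ.Vertex) : Subalgebra k (Δ.slTorus k qh X) :=
  (Δ.pglFullTorus k qh).comap (Δ.slTorus k qh X).val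

/-- The `SL₂` torus is a free (left) module over the `PGL₂` torus, of the given rank. -/
def IsFreeOfRank (X : Set Δ.Vertex) (r : ℕ) : Prop :=
  Nonempty (Module.Basis (Fin r) (Δ.pglTorus k qh X) (Δ.slTorus k qh X))

/-- There are monomials `M₁, …, Mₙ` in the `SL₂` torus, with `2 ^ n` equal to the given rank and
with squares in the `PGL₂` torus, such that the products `M₁ ^ ε₁ ⋯ Mₙ ^ εₙ` for
`ε ∈ {0, 1} ^ n` form a basis of the `SL₂` torus over the `PGL₂` torus. -/
def HasSquareRootBasis (X : Set Δ.Vertex) (r : ℕ) : Prop :=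
  ∃ (n : ℕ) (M : Fin n → Δ.slTorus k qh X),
    2 ^ n = r ∧
    (∀ i, ∃ w, (M i : Δ.Torus k qh) = Δ.monomial k qh w) ∧
    (∀ i, M i ^ 2 ∈ Δ.pglTorus k qh X) ∧
    ∃ b : Module.Basis (Fin n → Fin 2) (Δ.pglTorus k qh X) (Δ.slTorus k qh X),
      ∀ ε, b ε = (List.ofFn fun i => M i ^ (ε i : ℕ)).prod

end SurfaceTriangulation

end

/-!
The statement holds for every set `X` of open gates, not only for the four sets coming from
a notching.

Let `G` be the group of cellular `1`-chains mod `2` modulo the boundaries of the hexagons and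
rectangles. A word in the generators has a class in `G`, its exponent vector mod `2`. The relations
of the `SL₂` torus are homogeneous for these classes, since the digon relation only compares words
that differ by the boundary of a rectangle; hence the torus is graded by `G`, and monomials are
homogeneous units. The grading is encoded by a coaction into the monoid algebra of `G` over the
torus (`coaction`, `coaction_monomial`).

The `PGL₂` torus consists of elements of degree zero (`coaction_of_mem_pglFullTorus`), since
squares and hexagons have class zero. Conversely a monomial of class zero is in the `PGL₂` torus
(`monomial_mem_pglFullTorus`): monomials commute up to scalars, so it is, up to a scalar, a product
of squares, hexagon elements, and elements that equal `1` by the digon relations. Therefore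
monomials with degrees representing exactly once every degree that occurs in the part with gates
`X` open form a basis of this part of the `SL₂` torus over the one of the `PGL₂` torus
(`linearIndependent_slMonomial`, `span_slMonomial_eq_top`). It does not matter for this whether
`k` embeds into the torus, that is whether the homogeneous parts are free over `k`.

It remains to see that these degrees are the image of `H₁(S, X)` in `G`. The weight of a word is
mod `2` the boundary of its chain, so a word with weights zero outside `X` has a relative
cycle as chain (`exists_homologyToClass_eq`). Conversely, a word whose chain is a relative cycle has
even weights outside `X`, and it can be corrected by a word of class zero, because twice any vertex
is the weight of such a word: a product of squares, the hexagon of the triangle at that vertex, and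
inverses of these (`two_nsmul_single_mem_zeroClassWeights`, `exists_mem_invariantWords`). Words representing
a basis of `H₁(S, X)` over `ℤ/2` give the required monomials.
-/

noncomputable section

namespace SurfaceTriangulation

variable {T : Type*} (Δ : SurfaceTriangulation T) (k : Type*) [CommRing k] (qh : kˣ)

/-! ### Classes of words modulo boundaries of faces -/

/-- The group of `1`-chains with coefficients in `ℤ/2` modulo the boundaries of the faces. -/
abbrev ChainClass := (Δ.Edge →₀ ZMod 2) ⧸ LinearMap.range Δ.boundary₂

/-- The mod `2` exponent vector of a word, as a cellular `1`-chain. -/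
def wordChain : FreeGroup Δ.Edge →* Multiplicative (Δ.Edge →₀ ZMod 2) :=
  FreeGroup.lift fun e => Multiplicative.ofAdd (Δ.edgeChain e)

/-- The class of a word, that is its mod `2` exponent vector modulo the boundaries of the faces. -/
def wordClass (w : FreeGroup Δ.Edge) : Δ.ChainClass :=
  (LinearMap.range Δ.boundary₂).mkQ (Δ.wordChain w).toAdd

@[simp]
theorem wordChain_of (e : Δ.Edge) :
    Δ.wordChain (FreeGroup.of e) = Multiplicative.ofAdd (Δ.edgeChain e) := by
  simp [wordChain]

@[simp]
theorem wordClass_one : Δ.wordClass 1 = 0 := by simp [wordClass]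

@[simp]
theorem wordClass_mul (w w' : FreeGroup Δ.Edge) :
    Δ.wordClass (w * w') = Δ.wordClass w + Δ.wordClass w' := by simp [wordClass]

@[simp]
theorem wordClass_inv (w : FreeGroup Δ.Edge) : Δ.wordClass w⁻¹ = -Δ.wordClass w := by
  simp [wordClass]

@[simp]
theorem wordClass_pow (w : FreeGroup Δ.Edge) (m : ℕ) :
    Δ.wordClass (w ^ m) = m • Δ.wordClass w := by
  induction m with
  | zero => simp
  | succ m ih => rw [pow_succ, wordClass_mul, ih, succ_nsmul]

theorem wordClass_prod_ofFn {n : ℕ} (w : Fin n → FreeGroup Δ.Edge) :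
    Δ.wordClass (List.ofFn w).prod = ∑ i, Δ.wordClass (w i) := by
  rw [wordClass, map_list_prod, List.map_ofFn, List.prod_ofFn, toAdd_prod, map_sum]
  rfl

theorem ChainClass.add_self (x : Δ.ChainClass) : x + x = 0 := by
  rw [← two_smul (ZMod 2), show (2 : ZMod 2) = 0 from rfl, zero_smul]

theorem wordClass_sq (w : FreeGroup Δ.Edge) : Δ.wordClass (w ^ 2) = 0 := by
  rw [pow_two, wordClass_mul, ChainClass.add_self]

theorem wordClass_eq_zero_iff (w : FreeGroup Δ.Edge) :
    Δ.wordClass w = 0 ↔ (Δ.wordChain w).toAdd ∈ LinearMap.range Δ.boundary₂ := by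
  rw [wordClass, Submodule.mkQ_apply, Submodule.Quotient.mk_eq_zero]

variable {Δ} in
theorem wordChain_surjective (c : Δ.Edge →₀ ZMod 2) :
    ∃ w, (Δ.wordChain w).toAdd = c := by
  induction c using Finsupp.induction_linear with
  | zero => exact ⟨1, by simp⟩
  | add f g hf hg =>
    obtain ⟨w, rfl⟩ := hf
    obtain ⟨w', rfl⟩ := hg
    exact ⟨w * w', by simp⟩
  | single e x =>
    refine ⟨FreeGroup.of e ^ x.val, ?_⟩
    simp [edgeChain, ← Nat.cast_smul_eq_nsmul (ZMod 2)]

/-- The word around the hexagon in the triangle `τ`. -/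
def hexagonWord (τ : T) : FreeGroup Δ.Edge :=
  .of (.long (τ, 0)) * .of (.long (τ, 1)) * .of (.long (τ, 2)) *
    .of (.short (.hex (τ, 0))) * .of (.short (.hex (τ, 1))) * .of (.short (.hex (τ, 2)))

theorem monomial_hexagonWord (τ : T) :
    Δ.monomial k qh (Δ.hexagonWord τ) = Δ.hexagonElt k qh τ := by
  simp [monomial, hexagonWord, hexagonElt]

theorem wordChain_hexagonWord (τ : T) :
    (Δ.wordChain (Δ.hexagonWord τ)).toAdd = Δ.hexagonBoundary τ := by
  simp only [hexagonWord, map_mul, wordChain_of, toAdd_mul, toAdd_ofAdd, hexagonBoundary,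
    Fin.sum_univ_three]
  abel

theorem boundary₂_single_inl (τ : T) :
    Δ.boundary₂ (Finsupp.single (.inl τ) 1) = Δ.hexagonBoundary τ := by simp [boundary₂]

theorem wordClass_hexagonWord (τ : T) : Δ.wordClass (Δ.hexagonWord τ) = 0 := by
  rw [wordClass_eq_zero_iff, wordChain_hexagonWord]
  exact ⟨_, Δ.boundary₂_single_inl τ⟩

/-- The quotient of the two sides of the digon relation, a word in the four edges of the rectangle
joining `s` and `opp s`. -/
def rectangleWord (s : Δ.InnerSide) : FreeGroup Δ.Edge :=
  .of (.short (.rect s)) * .of (.long (Δ.opp s).1) *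
    (.of (.short (.rect (Δ.opp s))) * .of (.long s.1))⁻¹

theorem monomial_rectangleWord (s : Δ.InnerSide) :
    Δ.monomial k qh (Δ.rectangleWord s) = 1 := by
  rw [rectangleWord, map_mul, map_inv, mul_inv_eq_one]
  ext
  simpa [monomial, gen, freeA, freea] using RingQuot.mkAlgHom_rel k (FencingRel.digon (qh := qh) s)

theorem wordChain_rectangleWord (s : Δ.InnerSide) :
    (Δ.wordChain (Δ.rectangleWord s)).toAdd = Δ.rectangleBoundary (Quot.mk _ s) := by
  have neg (x : Δ.Edge →₀ ZMod 2) : -x = x := by ext; simp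
  simp only [rectangleWord, map_mul, map_inv, wordChain_of, toAdd_mul, toAdd_inv, toAdd_ofAdd,
    rectangleBoundary, neg]
  abel

theorem boundary₂_single_inr (r : Δ.Rectangle) :
    Δ.boundary₂ (Finsupp.single (.inr r) 1) = Δ.rectangleBoundary r := by simp [boundary₂]

/-! ### The grading of the torus by classes -/

theorem coe_gen (e : Δ.Edge) :
    (Δ.gen k qh e : Δ.Torus k qh) = RingQuot.mkAlgHom k _ (FreeAlgebra.ι k (e, false)) := rfl

/-- The coaction on the free algebra. Since chains are taken mod `2`, a generator and its inverse
have the same degree. -/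
def freeCoaction : Δ.FreeTorus k →ₐ[k] AddMonoidAlgebra (Δ.Torus k qh) Δ.ChainClass :=
  FreeAlgebra.lift k fun p => AddMonoidAlgebra.single (Δ.wordClass (.of p.1))
    (RingQuot.mkAlgHom k (Δ.FencingRel k qh) (FreeAlgebra.ι k p))

theorem freeCoaction_ι_mul_ι (p p' : Δ.Edge × Bool) :
    Δ.freeCoaction k qh (FreeAlgebra.ι k p * FreeAlgebra.ι k p') =
      AddMonoidAlgebra.single (Δ.wordClass (.of p.1) + Δ.wordClass (.of p'.1))
        (RingQuot.mkAlgHom k (Δ.FencingRel k qh) (FreeAlgebra.ι k p * FreeAlgebra.ι k p')) := by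
  simp [freeCoaction, AddMonoidAlgebra.single_mul_single]

theorem wordClass_digon (s : Δ.InnerSide) :
    Δ.wordClass (.of (.short (.rect s))) + Δ.wordClass (.of (.long (Δ.opp s).1)) =
      Δ.wordClass (.of (.short (.rect (Δ.opp s)))) + Δ.wordClass (.of (.long s.1)) := by
  have h : Δ.wordClass (Δ.rectangleWord s) = 0 := by
    rw [wordClass_eq_zero_iff, wordChain_rectangleWord]
    exact ⟨_, Δ.boundary₂_single_inr _⟩
  rwa [rectangleWord, wordClass_mul, wordClass_inv, wordClass_mul, wordClass_mul,
    ← sub_eq_add_neg, sub_eq_zero] at h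

/-- The defining relations of the torus are homogeneous: those of the rectangles because the
boundaries of the rectangles have class zero. -/
theorem freeCoaction_rel ⦃x y : Δ.FreeTorus k⦄ (h : Δ.FencingRel k qh x y) :
    Δ.freeCoaction k qh x = Δ.freeCoaction k qh y := by
  have hrel := RingQuot.mkAlgHom_rel k h
  cases h with
  | mul_inv e =>
    rw [freeCoaction_ι_mul_ι, hrel, ChainClass.add_self, map_one, map_one]; rfl
  | inv_mul e =>
    rw [freeCoaction_ι_mul_ι, hrel, ChainClass.add_self, map_one, map_one]; rfl
  | digon s =>
    simp only [freeA, freea] at hrel ⊢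
    rw [freeCoaction_ι_mul_ι, freeCoaction_ι_mul_ι, hrel, wordClass_digon]
  | long_long | short_long_comm | short_short_comm =>
    simp only [freeA, freea] at hrel ⊢
    rw [freeCoaction_ι_mul_ι, freeCoaction_ι_mul_ι, hrel, add_comm]
  | short_long | short_short =>
    simp only [freeA, freea] at hrel ⊢
    rw [map_smul, freeCoaction_ι_mul_ι, freeCoaction_ι_mul_ι, hrel, add_comm, map_smul,
      AddMonoidAlgebra.smul_single]

/-- The coaction defining the grading of the torus by classes: `x` is homogeneous of degree `g`
if and only if `x` is mapped to `single g x`. -/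
def coaction : Δ.Torus k qh →ₐ[k] AddMonoidAlgebra (Δ.Torus k qh) Δ.ChainClass :=
  RingQuot.liftAlgHom k ⟨Δ.freeCoaction k qh, Δ.freeCoaction_rel k qh⟩

theorem coaction_gen (e : Δ.Edge) :
    Δ.coaction k qh (Δ.gen k qh e) =
      AddMonoidAlgebra.single (Δ.wordClass (.of e)) (Δ.gen k qh e : Δ.Torus k qh) := by
  rw [coe_gen, coaction, RingQuot.liftAlgHom_mkAlgHom_apply, freeCoaction, FreeAlgebra.lift_ι_apply]

theorem coaction_gen_inv (e : Δ.Edge) :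
    Δ.coaction k qh ↑(Δ.gen k qh e)⁻¹ =
      AddMonoidAlgebra.single (Δ.wordClass (.of e)) (↑(Δ.gen k qh e)⁻¹ : Δ.Torus k qh) := by
  change Δ.coaction k qh (RingQuot.mkAlgHom k _ (FreeAlgebra.ι k (e, true))) = _
  rw [coaction, RingQuot.liftAlgHom_mkAlgHom_apply, freeCoaction, FreeAlgebra.lift_ι_apply]
  rfl

theorem coaction_monomial (w : FreeGroup Δ.Edge) :
    Δ.coaction k qh (Δ.monomial k qh w) =
      AddMonoidAlgebra.single (Δ.wordClass w) (Δ.monomial k qh w : Δ.Torus k qh) := by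
  induction w using FreeGroup.induction_on with
  | C1 => simp [AddMonoidAlgebra.one_def]
  | of e => simpa [monomial] using Δ.coaction_gen k qh e
  | inv_of e _ =>
    have h : -Δ.wordClass (.of e) = Δ.wordClass (.of e) :=
      neg_eq_of_add_eq_zero_left (ChainClass.add_self Δ _)
    simpa [monomial, h] using Δ.coaction_gen_inv k qh e
  | mul w w' h h' => simp [h, h', AddMonoidAlgebra.single_mul_single]

/-- The `PGL₂` torus is homogeneous of degree zero. -/
theorem coaction_of_mem_pglFullTorus {x : Δ.Torus k qh} (hx : x ∈ Δ.pglFullTorus k qh) :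
    Δ.coaction k qh x = AddMonoidAlgebra.single 0 x := by
  suffices h : Δ.pglFullTorus k qh ≤
      AlgHom.equalizer (Δ.coaction k qh) AddMonoidAlgebra.singleZeroAlgHom from h hx
  have key (w) (hw : Δ.wordClass w = 0) : (Δ.monomial k qh w : Δ.Torus k qh) ∈
      AlgHom.equalizer (Δ.coaction k qh) AddMonoidAlgebra.singleZeroAlgHom := by
    simp [AlgHom.mem_equalizer, coaction_monomial, hw]
  have hgen (e) : Δ.gen k qh e = Δ.monomial k qh (.of e) := by simp [monomial]
  refine Algebra.adjoin_le ?_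
  rintro _ (⟨e, rfl | rfl⟩ | ⟨τ, rfl | rfl⟩)
  · rw [hgen, ← map_zpow]
    exact key _ (Δ.wordClass_sq _)
  · rw [hgen, ← map_zpow, zpow_neg]
    exact key _ (by rw [wordClass_inv, neg_eq_zero]; exact Δ.wordClass_sq _)
  · rw [← monomial_hexagonWord]
    exact key _ (Δ.wordClass_hexagonWord τ)
  · rw [← monomial_hexagonWord, ← map_inv]
    exact key _ (by rw [wordClass_inv, wordClass_hexagonWord, neg_zero])

/-! ### Monomials in the `PGL₂` torus -/

/-- The units of the `SL₂` torus that lie in the `PGL₂` torus together with their inverses. -/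
def pglUnits : Subgroup (Δ.Torus k qh)ˣ where
  carrier := {x | (x : Δ.Torus k qh) ∈ Δ.pglFullTorus k qh ∧
    (↑x⁻¹ : Δ.Torus k qh) ∈ Δ.pglFullTorus k qh}
  one_mem' := by simp [one_mem]
  mul_mem' := by
    rintro x y ⟨hx, hx'⟩ ⟨hy, hy'⟩
    exact ⟨by simpa using mul_mem hx hy, by simpa using mul_mem hy' hx'⟩
  inv_mem' := by
    rintro x ⟨hx, hx'⟩
    exact ⟨hx', by simpa using hx⟩

/-- The scalars among the units of the torus. -/
def scalarUnits : Subgroup (Δ.Torus k qh)ˣ :=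
  (Units.map (algebraMap k (Δ.Torus k qh)).toMonoidHom).range

theorem scalarUnits_le_pglUnits : Δ.scalarUnits k qh ≤ Δ.pglUnits k qh := by
  rintro _ ⟨c, rfl⟩
  exact ⟨(Δ.pglFullTorus k qh).algebraMap_mem _, (Δ.pglFullTorus k qh).algebraMap_mem _⟩

instance : (Δ.scalarUnits k qh).Normal where
  conj_mem := by
    rintro _ ⟨c, rfl⟩ x
    refine ⟨c, ?_⟩
    rw [eq_mul_inv_iff_mul_eq]
    ext
    exact Algebra.commutes _ _

/-- Generators commute up to powers of `q ^ (1 / 2)`. -/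
theorem gen_mul_gen_comm (e e' : Δ.Edge) :
    ∃ c : kˣ, (Δ.gen k qh e * Δ.gen k qh e' : Δ.Torus k qh) =
      (c : k) • (Δ.gen k qh e' * Δ.gen k qh e : Δ.Torus k qh) := by
  have symm {x y : Δ.Torus k qh} (h : ∃ c : kˣ, x = (c : k) • y) : ∃ c : kˣ, y = (c : k) • x := by
    obtain ⟨c, rfl⟩ := h
    exact ⟨c⁻¹, by rw [smul_smul, Units.inv_mul, one_smul]⟩
  have rel {x y : Δ.FreeTorus k} (h : Δ.FencingRel k qh x y) := RingQuot.mkAlgHom_rel k h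
  have mixed (e : Δ.ShortEdge) (s : TriangleSide T) :
      ∃ c : kˣ, (Δ.gen k qh (.short e) * Δ.gen k qh (.long s) : Δ.Torus k qh) =
        (c : k) • (Δ.gen k qh (.long s) * Δ.gen k qh (.short e) : Δ.Torus k qh) := by
    by_cases h : e.Touches s
    · exact ⟨qh, by simpa [coe_gen, freeA, freea] using rel (.short_long e s h)⟩
    · exact ⟨1, by simpa [coe_gen, freeA, freea] using rel (.short_long_comm e s h)⟩
  have short (e e' : Δ.ShortEdge) (h : e.head = e'.tail) (h' : e.tail ≠ e'.head) :
      ∃ c : kˣ, (Δ.gen k qh (.short e) * Δ.gen k qh (.short e') : Δ.Torus k qh) =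
        (c : k) • (Δ.gen k qh (.short e') * Δ.gen k qh (.short e) : Δ.Torus k qh) :=
    ⟨qh, by simpa [coe_gen, freea] using rel (.short_short e e' h h')⟩
  cases e with
  | long s =>
    cases e' with
    | long s' => exact ⟨1, by simpa [coe_gen, freeA] using rel (.long_long s s')⟩
    | short e' => exact symm (mixed e' s)
  | short e =>
    cases e' with
    | long s' => exact mixed e s'
    | short e' =>
      by_cases h : e.head = e'.tail ↔ e.tail = e'.head
      · exact ⟨1, by simpa [coe_gen, freea] using rel (.short_short_comm e e' h)⟩
      · by_cases h1 : e.head = e'.tail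
        · exact short e e' h1 fun h2 => h ⟨fun _ => h2, fun _ => h1⟩
        · have h2 : e.tail = e'.head := by tauto
          exact symm (short e' e h2.symm fun h3 => h1 h3.symm)

/-- Monomials commute up to scalars. -/
theorem commute_mk_monomial (w w' : FreeGroup Δ.Edge) :
    Commute (Δ.monomial k qh w : (Δ.Torus k qh)ˣ ⧸ Δ.scalarUnits k qh)
      (Δ.monomial k qh w') := by
  have hgen (e e' : Δ.Edge) : Commute (Δ.gen k qh e : (Δ.Torus k qh)ˣ ⧸ Δ.scalarUnits k qh)
      (Δ.gen k qh e') := by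
    obtain ⟨c, hc⟩ := Δ.gen_mul_gen_comm k qh e' e
    rw [commute_iff_eq, ← QuotientGroup.mk_mul, ← QuotientGroup.mk_mul, QuotientGroup.eq]
    refine ⟨c, ?_⟩
    rw [eq_inv_mul_iff_mul_eq]
    ext
    simpa [Algebra.smul_def, Algebra.commutes] using hc.symm
  induction w using FreeGroup.induction_on with
  | C1 => simp
  | inv_of e h => simpa using h
  | mul w₁ w₂ h₁ h₂ => simpa using h₁.mul_left h₂
  | of e =>
    induction w' using FreeGroup.induction_on with
    | C1 => simp
    | of e' => simpa [monomial] using hgen e e'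
    | inv_of e' h => simpa using h
    | mul w₁ w₂ h₁ h₂ => simpa using h₁.mul_right h₂

/-- The words whose monomials are units of the `PGL₂` torus. -/
def pglWords : Subgroup (FreeGroup Δ.Edge) := (Δ.pglUnits k qh).comap (Δ.monomial k qh)

theorem commutator_mem_pglWords (w w' : FreeGroup Δ.Edge) :
    w * w' * w⁻¹ * w'⁻¹ ∈ Δ.pglWords k qh := by
  refine Δ.scalarUnits_le_pglUnits k qh ?_
  have h := (Δ.commute_mk_monomial k qh w'⁻¹ w⁻¹).eq
  rw [← QuotientGroup.mk_mul, ← QuotientGroup.mk_mul, QuotientGroup.eq] at h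
  simpa [mul_assoc] using h

instance : (Δ.pglWords k qh).Normal where
  conj_mem w hw g := by
    simpa using mul_mem (Δ.commutator_mem_pglWords k qh g w) hw

/-- The free group modulo the words of the `PGL₂` torus is commutative. -/
instance : CommGroup (FreeGroup Δ.Edge ⧸ Δ.pglWords k qh) where
  mul_comm x y := by
    induction x using QuotientGroup.induction_on with | H w => ?_
    induction y using QuotientGroup.induction_on with | H w' => ?_
    rw [← QuotientGroup.mk_mul, ← QuotientGroup.mk_mul, QuotientGroup.eq]
    simpa [mul_assoc] using Δ.commutator_mem_pglWords k qh w'⁻¹ w⁻¹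

theorem gen_sq_mem_pglUnits (e : Δ.Edge) : Δ.gen k qh e ^ 2 ∈ Δ.pglUnits k qh :=
  ⟨Algebra.subset_adjoin (.inl ⟨e, .inl (by norm_cast)⟩),
    Algebra.subset_adjoin (.inl ⟨e, .inr (by rw [zpow_neg]; norm_cast)⟩)⟩

theorem hexagonElt_mem_pglUnits (τ : T) : Δ.hexagonElt k qh τ ∈ Δ.pglUnits k qh :=
  ⟨Algebra.subset_adjoin (.inr ⟨τ, .inl rfl⟩), Algebra.subset_adjoin (.inr ⟨τ, .inr rfl⟩)⟩

/-- The free group modulo the words of the `PGL₂` torus has exponent two, so that it is a vector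
space over `ℤ/2`. -/
instance : Module (ZMod 2) (Additive (FreeGroup Δ.Edge ⧸ Δ.pglWords k qh)) :=
  AddCommGroup.zmodModule fun x => by
    induction x using Additive.rec with | ofMul x => ?_
    rw [← ofMul_pow, ofMul_eq_zero]
    induction x using QuotientGroup.induction_on with | H w => ?_
    induction w using FreeGroup.induction_on with
    | C1 => simp
    | of e =>
      rw [← QuotientGroup.mk_pow, QuotientGroup.eq_one_iff]
      simpa [pglWords, monomial] using Δ.gen_sq_mem_pglUnits k qh e
    | inv_of e h => rw [QuotientGroup.mk_inv, inv_pow, h, inv_one]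
    | mul w w' h h' => rw [QuotientGroup.mk_mul, mul_pow, h, h', mul_one]

/-- Chains mod `2` act as words modulo the words of the `PGL₂` torus. -/
def chainToQuotient :
    (Δ.Edge →₀ ZMod 2) →ₗ[ZMod 2] Additive (FreeGroup Δ.Edge ⧸ Δ.pglWords k qh) :=
  Finsupp.linearCombination (ZMod 2) fun e => Additive.ofMul (FreeGroup.of e : _ ⧸ _)

theorem chainToQuotient_wordChain (w : FreeGroup Δ.Edge) :
    Δ.chainToQuotient k qh (Δ.wordChain w).toAdd = Additive.ofMul (w : _ ⧸ _) := by
  induction w using FreeGroup.induction_on with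
  | C1 => simp
  | of e => simp [chainToQuotient, edgeChain]
  | inv_of e h => rw [map_inv, toAdd_inv, map_neg, h, QuotientGroup.mk_inv, ofMul_inv]
  | mul w w' h h' => rw [map_mul, toAdd_mul, map_add, h, h', QuotientGroup.mk_mul, ofMul_mul]

theorem chainToQuotient_comp_boundary₂ : Δ.chainToQuotient k qh ∘ₗ Δ.boundary₂ = 0 := by
  have key (w) (hw : w ∈ Δ.pglWords k qh) :
      Δ.chainToQuotient k qh (Δ.wordChain w).toAdd = 0 := by
    rw [chainToQuotient_wordChain, ofMul_eq_zero, QuotientGroup.eq_one_iff]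
    exact hw
  apply Finsupp.lhom_ext'
  rintro (τ | r) <;> ext1
  · change Δ.chainToQuotient k qh (Δ.boundary₂ (Finsupp.single (.inl τ) 1)) = 0
    rw [boundary₂_single_inl, ← wordChain_hexagonWord]
    refine key _ ?_
    rw [pglWords, Subgroup.mem_comap, monomial_hexagonWord]
    exact Δ.hexagonElt_mem_pglUnits k qh τ
  · change Δ.chainToQuotient k qh (Δ.boundary₂ (Finsupp.single (.inr r) 1)) = 0
    rw [boundary₂_single_inr]
    induction r using Quot.ind with | mk s => ?_
    rw [← wordChain_rectangleWord]
    refine key _ ?_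
    rw [pglWords, Subgroup.mem_comap, monomial_rectangleWord]
    exact one_mem _

/-- A word of class zero gives a monomial in the `PGL₂` torus. Up to a scalar, the monomial is
a product of squares, hexagon elements, and the elements equal to `1` by the digon relations. -/
theorem monomial_mem_pglFullTorus {w : FreeGroup Δ.Edge} (hw : Δ.wordClass w = 0) :
    (Δ.monomial k qh w : Δ.Torus k qh) ∈ Δ.pglFullTorus k qh := by
  obtain ⟨f, hf⟩ := (Δ.wordClass_eq_zero_iff w).1 hw
  have h := Δ.chainToQuotient_wordChain k qh w
  rw [← hf, ← LinearMap.comp_apply, chainToQuotient_comp_boundary₂, LinearMap.zero_apply,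
    eq_comm, ofMul_eq_zero, QuotientGroup.eq_one_iff] at h
  exact h.1

/-! ### Weights and relative cycles -/

@[simp]
theorem weight_of (e : Δ.Edge) :
    Δ.weight (FreeGroup.of e) = Multiplicative.ofAdd (Δ.edgeWeight e) := by
  simp [weight]

/-- The boundary of the chain of a word is its weight mod `2`. -/
theorem boundary₁_wordChain (w : FreeGroup Δ.Edge) (u : Δ.Vertex) :
    Δ.boundary₁ (Δ.wordChain w).toAdd u = ((Δ.weight w).toAdd u : ZMod 2) := by
  classical
  induction w using FreeGroup.induction_on with
  | C1 => simp
  | inv_of e h =>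
    rw [map_inv Δ.wordChain, map_inv Δ.weight, toAdd_inv, toAdd_inv, map_neg, Finsupp.neg_apply,
      Finsupp.neg_apply, h, Int.cast_neg]
  | mul w w' h h' => simp [h, h']
  | of e =>
    cases e with
    | long s => simp [boundary₁, edgeChain, edgeBoundary, edgeWeight, Finsupp.single_apply]
    | short e =>
      simp [boundary₁, edgeChain, edgeBoundary, edgeWeight, Finsupp.single_apply,
        CharTwo.sub_eq_add]

variable {Δ} in
theorem relBoundary₁_eq_zero_iff {X : Set Δ.Vertex} {c : Δ.Edge →₀ ZMod 2} :
    Δ.relBoundary₁ X c = 0 ↔ ∀ u ∉ X, Δ.boundary₁ c u = 0 := by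
  rw [relBoundary₁, LinearMap.comp_apply, Submodule.mkQ_apply, Submodule.Quotient.mk_eq_zero,
    Finsupp.mem_supported']

/-- The weights of the words of class zero. -/
def zeroClassWeights : AddSubgroup (Δ.Vertex →₀ ℤ) where
  carrier := {y | ∃ w, Δ.wordClass w = 0 ∧ (Δ.weight w).toAdd = y}
  zero_mem' := ⟨1, by simp, by simp⟩
  add_mem' := by
    rintro _ _ ⟨w, hw, rfl⟩ ⟨w', hw', rfl⟩
    exact ⟨w * w', by simp [hw, hw'], by simp⟩
  neg_mem' := by
    rintro _ ⟨w, hw, rfl⟩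
    exact ⟨w⁻¹, by simp [hw], by simp⟩

/-- Twice a vertex is the weight of a word of class zero. Modulo the weights of the squares of the
generators, the vertices `2 • (s, true)` for the three sides `s` of a triangle agree up to sign,
and the sum of these three is the weight of the hexagon. -/
theorem two_nsmul_single_mem_zeroClassWeights (u : Δ.Vertex) :
    2 • Finsupp.single u 1 ∈ Δ.zeroClassWeights := by
  obtain ⟨⟨τ, i⟩, b⟩ := u
  let v (i : Fin 3) (b : Bool) : Δ.Vertex →₀ ℤ := Finsupp.single ((τ, i), b) 1
  have hlong (i : Fin 3) : 2 • (v i false + v i true) ∈ Δ.zeroClassWeights :=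
    ⟨.of (.long (τ, i)) ^ 2, Δ.wordClass_sq _, by simp [edgeWeight, v]⟩
  have hshort (i : Fin 3) : 2 • (v i true - v (i + 1) false) ∈ Δ.zeroClassWeights :=
    ⟨.of (.short (.hex (τ, i))) ^ 2, Δ.wordClass_sq _, by
      simp [edgeWeight, v, ShortEdge.tail, ShortEdge.head]⟩
  have hhex : 2 • (v i true + v (i + 1) true + v (i + 2) true) ∈ Δ.zeroClassWeights := by
    refine ⟨Δ.hexagonWord τ, Δ.wordClass_hexagonWord τ, ?_⟩
    simp only [hexagonWord, map_mul, weight_of, toAdd_mul, toAdd_ofAdd, edgeWeight,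
      ShortEdge.tail, ShortEdge.head]
    change v 0 false + v 0 true + (v 1 false + v 1 true) + (v 2 false + v 2 true) +
      (v 0 true - v 1 false) + (v 1 true - v 2 false) + (v 2 true - v 0 false) = _
    fin_cases i <;> simp only [Fin.reduceFinMk, Fin.reduceAdd, Fin.zero_eta, Fin.mk_one] <;> abel
  have htrue : 2 • v i true ∈ Δ.zeroClassWeights := by
    have h12 : i + 1 + 1 = i + 2 := by rw [add_assoc]; rfl
    have h := sub_mem hhex (add_mem (hlong (i + 2)) (hshort (i + 1)))
    rw [h12] at h
    convert h using 1
    abel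
  cases b with
  | true => exact htrue
  | false =>
    convert sub_mem (hlong i) htrue using 1
    change 2 • v i false = _
    abel

theorem two_nsmul_mem_zeroClassWeights (y : Δ.Vertex →₀ ℤ) : 2 • y ∈ Δ.zeroClassWeights := by
  induction y using Finsupp.induction_linear with
  | zero => simp
  | add y y' h h' => rw [nsmul_add]; exact add_mem h h'
  | single u m =>
    rw [← mul_one m, ← smul_eq_mul, ← Finsupp.smul_single, smul_comm]
    exact zsmul_mem (Δ.two_nsmul_single_mem_zeroClassWeights u) m

variable {Δ} in
theorem inv_mem_invariantWords {X : Set Δ.Vertex} {w : FreeGroup Δ.Edge}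
    (hw : w ∈ Δ.invariantWords X) : w⁻¹ ∈ Δ.invariantWords X := by
  intro u hu
  simp [hw u hu]

/-- The relative homology `H₁(S, X)` as a subspace of the chains modulo boundaries. -/
def homologyToClass (X : Set Δ.Vertex) : Δ.H₁ X →ₗ[ZMod 2] Δ.ChainClass :=
  Submodule.mapQ _ _ (LinearMap.ker (Δ.relBoundary₁ X)).subtype le_rfl

theorem homologyToClass_injective (X : Set Δ.Vertex) :
    Function.Injective (Δ.homologyToClass X) := by
  rw [injective_iff_map_eq_zero]
  intro h hh
  induction h using Submodule.Quotient.induction_on with | H c => ?_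
  have hh : (Submodule.Quotient.mk c.1 : Δ.ChainClass) = 0 := hh
  rw [Submodule.Quotient.mk_eq_zero] at hh
  rw [Submodule.Quotient.mk_eq_zero]
  exact hh

/-- The class of a word with weight zero outside `X` is a relative homology class. -/
theorem exists_homologyToClass_eq {X : Set Δ.Vertex} {w : FreeGroup Δ.Edge}
    (hw : w ∈ Δ.invariantWords X) : ∃ h, Δ.homologyToClass X h = Δ.wordClass w := by
  refine ⟨Submodule.Quotient.mk ⟨(Δ.wordChain w).toAdd, ?_⟩, rfl⟩
  rw [LinearMap.mem_ker, relBoundary₁_eq_zero_iff]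
  intro u hu
  rw [boundary₁_wordChain, hw u hu, Int.cast_zero]

/-- Every relative homology class is the class of a word with weight zero outside `X`. A word with
the given chain has even weights outside `X`, and these are the weights of a word of
class zero. -/
theorem exists_mem_invariantWords {X : Set Δ.Vertex} (h : Δ.H₁ X) :
    ∃ w ∈ Δ.invariantWords X, Δ.wordClass w = Δ.homologyToClass X h := by
  classical
  induction h using Submodule.Quotient.induction_on with | H c => ?_
  obtain ⟨c, hc⟩ := c
  obtain ⟨w, rfl⟩ := wordChain_surjective c
  rw [LinearMap.mem_ker, relBoundary₁_eq_zero_iff] at hc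
  obtain ⟨w', hw', hy⟩ := Δ.two_nsmul_mem_zeroClassWeights
    ((Δ.weight w).toAdd.mapRange (· / 2) (by simp))
  refine ⟨w * w'⁻¹, fun u hu => ?_, ?_⟩
  · have h2 : (2 : ℤ) ∣ (Δ.weight w).toAdd u := by
      rw [← Nat.cast_two, ← ZMod.intCast_zmod_eq_zero_iff_dvd, ← boundary₁_wordChain]
      exact hc u hu
    simp [hy]
    omega
  · rw [wordClass_mul, wordClass_inv, hw', neg_zero, add_zero]
    rfl

/-! ### The basis -/

instance [Finite T] : Finite Δ.Edge :=
  Finite.of_surjective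
    (Sum.elim .long (.short ∘ Sum.elim .hex .rect) :
      TriangleSide T ⊕ TriangleSide T ⊕ Δ.InnerSide → Δ.Edge) <| by
    rintro (s | s | s)
    · exact ⟨.inl s, rfl⟩
    · exact ⟨.inr (.inl s), rfl⟩
    · exact ⟨.inr (.inr s), rfl⟩

section

variable {Δ} {X : Set Δ.Vertex}

/-- The monomial of a word with weight zero outside `X`, as an element of the `SL₂` torus. -/
def slMonomial (w : Δ.invariantWords X) : Δ.slTorus k qh X :=
  ⟨Δ.monomial k qh w, Submodule.subset_span ⟨w, w.2, rfl⟩⟩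

theorem slMonomial_mul (w w' : Δ.invariantWords X) :
    slMonomial k qh (w * w') = slMonomial k qh w * slMonomial k qh w' :=
  Subtype.ext (by simp [slMonomial])

theorem slMonomial_pow (w : Δ.invariantWords X) (m : ℕ) :
    slMonomial k qh (w ^ m) = slMonomial k qh w ^ m :=
  Subtype.ext (by simp [slMonomial])

theorem slMonomial_prod_ofFn {n : ℕ} (w : Fin n → Δ.invariantWords X) :
    slMonomial k qh (List.ofFn w).prod = (List.ofFn fun i => slMonomial k qh (w i)).prod := by
  let f : Δ.invariantWords X →* Δ.slTorus k qh X :=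
    { toFun := slMonomial k qh
      map_one' := Subtype.ext (by simp [slMonomial])
      map_mul' := slMonomial_mul k qh }
  change f _ = _
  rw [map_list_prod, List.map_ofFn]
  rfl

theorem slMonomial_mem_pglTorus {w : Δ.invariantWords X} (hw : Δ.wordClass w = 0) :
    slMonomial k qh w ∈ Δ.pglTorus k qh X :=
  Δ.monomial_mem_pglFullTorus k qh hw

theorem span_range_slMonomial :
    Submodule.span k (Set.range (slMonomial k qh : Δ.invariantWords X → Δ.slTorus k qh X)) = ⊤ := by
  apply Submodule.map_injective_of_injective
    (f := (Δ.slTorus k qh X).val.toLinearMap) Subtype.val_injective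
  rw [Submodule.map_span, Submodule.map_top, ← Set.range_comp]
  ext x
  have h : x ∈ LinearMap.range (Δ.slTorus k qh X).val.toLinearMap ↔
      x ∈ Submodule.span k
        ((fun w => (Δ.monomial k qh w : Δ.Torus k qh)) '' (Δ.invariantWords X)) :=
    ⟨by rintro ⟨y, rfl⟩; exact y.2, fun hx => ⟨⟨x, hx⟩, rfl⟩⟩
  rw [h, Set.image_eq_range]
  rfl

/-- The term `p • M` of a linear combination of monomials over the `PGL₂` torus is homogeneous,
of the degree of `M`. -/
theorem coaction_smul_slMonomial (p : Δ.pglTorus k qh X) (w : Δ.invariantWords X) :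
    Δ.coaction k qh ↑(p • slMonomial k qh w) =
      AddMonoidAlgebra.single (Δ.wordClass w) (↑(p • slMonomial k qh w) : Δ.Torus k qh) := by
  have h : (↑(p • slMonomial k qh w) : Δ.Torus k qh) = p.1.1 * Δ.monomial k qh w := rfl
  have hp : Δ.coaction k qh p.1.1 = AddMonoidAlgebra.single 0 p.1.1 :=
    Δ.coaction_of_mem_pglFullTorus k qh p.2
  rw [h, map_mul, coaction_monomial, hp, AddMonoidAlgebra.single_mul_single, zero_add]

/-- Monomials of different degrees are linearly independent over the `PGL₂` torus, because they are
homogeneous units. -/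
theorem linearIndependent_slMonomial {ι : Type*} [Fintype ι] (w : ι → Δ.invariantWords X)
    (hw : Function.Injective fun i => Δ.wordClass (w i)) :
    LinearIndependent (Δ.pglTorus k qh X) fun i => slMonomial k qh (w i) := by
  classical
  refine Fintype.linearIndependent_iffₛ.2 ?_
  intro p p' hp i
  have h := congrArg (fun x : Δ.slTorus k qh X =>
    (Δ.coaction k qh x).coeff (Δ.wordClass (w i))) hp
  simp only [AddSubmonoidClass.coe_finsetSum, map_sum, coaction_smul_slMonomial,
    AddMonoidAlgebra.coeff_sum, Finsupp.finsetSum_apply, AddMonoidAlgebra.coeff_single,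
    Finsupp.single_apply, hw.eq_iff, Finset.sum_ite_eq', Finset.mem_univ, if_true] at h
  have h' : (p i).1.1 * Δ.monomial k qh (w i) = (p' i).1.1 * Δ.monomial k qh (w i) := h
  exact Subtype.ext (Subtype.ext ((Units.mul_left_inj _).1 h'))

/-- Monomials representing all degrees span the `SL₂` torus over the `PGL₂` torus. -/
theorem span_slMonomial_eq_top {ι : Type*} (w : ι → Δ.invariantWords X)
    (hw : ∀ v ∈ Δ.invariantWords X, ∃ i, Δ.wordClass (w i) = Δ.wordClass v) :
    Submodule.span (Δ.pglTorus k qh X) (Set.range fun i => slMonomial k qh (w i)) = ⊤ := by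
  rw [← Submodule.restrictScalars_eq_top_iff k, eq_top_iff, ← span_range_slMonomial,
    Submodule.span_le]
  rintro _ ⟨v, rfl⟩
  obtain ⟨i, hi⟩ := hw v v.2
  let v' : Δ.invariantWords X := v * ⟨_, inv_mem_invariantWords (w i).2⟩
  have hv' : Δ.wordClass v' = 0 := by simp [v', hi]
  have h : slMonomial k qh v =
      (⟨slMonomial k qh v', slMonomial_mem_pglTorus k qh hv'⟩ : Δ.pglTorus k qh X) •
        slMonomial k qh (w i) := by
    change _ = slMonomial k qh v' * _
    rw [← slMonomial_mul]
    congr 1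
    exact Subtype.ext (by simp [v'])
  rw [h]
  exact Submodule.smul_mem _ _ (Submodule.subset_span (Set.mem_range_self i))

end

/-- The monomials are chosen with degrees a basis of `H₁(S, X)`. This holds for every set `X` of
open gates. -/
theorem hasSquareRootBasis_card_H₁ [Finite T] (X : Set Δ.Vertex) :
    Δ.HasSquareRootBasis k qh X (Nat.card (Δ.H₁ X)) := by
  let n := Module.finrank (ZMod 2) (Δ.H₁ X)
  let b : Module.Basis (Fin n) (ZMod 2) (Δ.H₁ X) := Module.finBasis _ _
  choose w hw hwb using fun i => Δ.exists_mem_invariantWords (b i)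
  let w' (i : Fin n) : Δ.invariantWords X := ⟨w i, hw i⟩
  let v (ε : Fin n → Fin 2) : Δ.invariantWords X := (List.ofFn fun i => w' i ^ (ε i : ℕ)).prod
  -- Exponents `0` and `1` are coordinates with respect to `b`.
  let c : (Fin n → Fin 2) ≃ Δ.H₁ X :=
    (Equiv.piCongrRight fun _ => (ZMod.finEquiv 2).toEquiv).trans b.equivFun.symm.toEquiv
  have hv (ε : Fin n → Fin 2) : Δ.wordClass (v ε) = Δ.homologyToClass X (c ε) := by
    have hcoe : (v ε : FreeGroup Δ.Edge) = (List.ofFn fun i => w i ^ (ε i : ℕ)).prod := by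
      simp only [v, Submonoid.coe_list_prod, List.map_ofFn]
      rfl
    have hc : c ε = ∑ i, ZMod.finEquiv 2 (ε i) • b i := b.equivFun_symm_apply _
    have hcast (x : Fin 2) : ((x : ℕ) : ZMod 2) = ZMod.finEquiv 2 x := by revert x; decide
    rw [hcoe, wordClass_prod_ofFn, hc, map_sum]
    refine Finset.sum_congr rfl fun i _ => ?_
    rw [wordClass_pow, hwb, map_smul, ← Nat.cast_smul_eq_nsmul (ZMod 2), hcast]
  have hinj : Function.Injective fun ε => Δ.wordClass (v ε) := by
    simp only [hv]
    exact (Δ.homologyToClass_injective X).comp c.injective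
  have hsurj : ∀ u ∈ Δ.invariantWords X, ∃ ε, Δ.wordClass (v ε) = Δ.wordClass u := by
    intro u hu
    obtain ⟨h, hh⟩ := Δ.exists_homologyToClass_eq hu
    exact ⟨c.symm h, by rw [hv, c.apply_symm_apply, hh]⟩
  refine ⟨n, fun i => slMonomial k qh (w' i), ?_, fun i => ⟨w i, rfl⟩, fun i => ?_,
    Module.Basis.mk (linearIndependent_slMonomial k qh v hinj)
      (span_slMonomial_eq_top k qh v hsurj).ge, fun ε => ?_⟩
  · rw [Module.natCard_eq_pow_finrank (K := ZMod 2), Nat.card_zmod]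
  · rw [← slMonomial_pow]
    exact slMonomial_mem_pglTorus k qh (Δ.wordClass_sq (w i))
  · rw [Module.Basis.mk_apply, slMonomial_prod_ofFn]
    simp only [slMonomial_pow]

variable {Δ k qh} in
theorem HasSquareRootBasis.isFreeOfRank {X : Set Δ.Vertex} {r : ℕ}
    (h : Δ.HasSquareRootBasis k qh X r) : Δ.IsFreeOfRank k qh X r := by
  obtain ⟨n, _, rfl, _, _, b, _⟩ := h
  exact ⟨b.reindex finFunctionFinEquiv⟩

end SurfaceTriangulation

end

/-- In the order `η`, `χ`, `ζ`, `ζ̃`: the gates left open are none, those at the marked points,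
those at the marked points and punctures, and all gates. -/
theorem mainTheorem10 {T : Type*} [Finite T] (Δ : SurfaceTriangulation T) (N : Δ.Notching)
    (k : Type*) [CommRing k] (qh : kˣ) :
    (Δ.IsFreeOfRank k qh ∅ (Nat.card (Δ.H₁ ∅)) ∧
      Δ.HasSquareRootBasis k qh ∅ (Nat.card (Δ.H₁ ∅))) ∧
    (Δ.IsFreeOfRank k qh N.markedGates (Nat.card (Δ.H₁ N.markedGates)) ∧
      Δ.HasSquareRootBasis k qh N.markedGates (Nat.card (Δ.H₁ N.markedGates))) ∧
    (Δ.IsFreeOfRank k qh N.gates (Nat.card (Δ.H₁ N.gates)) ∧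
      Δ.HasSquareRootBasis k qh N.gates (Nat.card (Δ.H₁ N.gates))) ∧
    (Δ.IsFreeOfRank k qh Set.univ (Nat.card (Δ.H₁ Set.univ)) ∧
      Δ.HasSquareRootBasis k qh Set.univ (Nat.card (Δ.H₁ Set.univ))) := by
  have h (X : Set Δ.Vertex) : Δ.IsFreeOfRank k qh X (Nat.card (Δ.H₁ X)) ∧
      Δ.HasSquareRootBasis k qh X (Nat.card (Δ.H₁ X)) :=
    ⟨(Δ.hasSquareRootBasis_card_H₁ k qh X).isFreeOfRank, Δ.hasSquareRootBasis_card_H₁ k qh X⟩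
  exact ⟨h _, h _, h _, h _⟩
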